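/- For $i\in\{1,\dots,n-1\}$ let $s_i=(i\ \,i{+}1)\in\mathfrak S_n$, let $\ell(u)$ be the number of inversions of $u\in\mathfrak S_n$, and let $\tau_i(u)=us_i$ if $\ell(us_i)>\ell(u)$ and $\tau_i(u)=u$ otherwise. The Demazure product on $\mathfrak S_n$ is $u\star v=\tau_{i_r}(\cdots\tau_{i_1}(u)\cdots)$, where $s_{i_1}\cdots s_{i_r}$ is a reduced word for $v$; it is the unique associative product with identity element $\mathrm{id}$ and $u\star s_i=\tau_i(u)$. For $w\in\mathfrak S_k$ and $u\in\mathfrak S_n$, let $\mathcal D_w(u)=\mathcal N_w(u)/\binom nk$, where $\mathcal N_w(u)$ is the number of tuples $i_1<\dots<i_k$ for which $u(i_1),\dots,u(i_k)$ has the same relative order as $w(1),\dots,w(k)$. Let $\delta_k$ be the decreasing permutation in $\mathfrak S_k$. A permuton is a probability measure on $[0,1]^2$ with uniform marginals; its height function is $\mathbf H_\mu(x,y)=\mu([x,1]\times[0,y])$. The Demazure product $\mu\star\nu$ of permutons $\mu,\nu$ is the permuton with $\mathbf H_{\mu\star\nu}(x,y)=\min_{0\le\gamma\le1}\bigl(\mathbf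 H_\mu(\gamma,y)+\mathbf H_\nu(x,\gamma)\bigr)$ for all $x,y\in[0,1]$. **Theorem.** For all $n$, let $u_n,v_n$ be random permutations in $\mathfrak S_n$, defined on a common probability space, such that for each $n$ the permutations $u_n$ and $v_n$ are independent and uniformly distributed on $\mathfrak S_n$ (no assumption is made on the joint law for different $n$; in particular, $(u_n)$ and $(v_n)$ may be independent sequences of independent permutations). Then: 1. For every $k$ and every permutation $w\in\mathfrak S_k$, almost surely $$\lim_{n\to\infty}\mathcal D_w(u_n\star v_n)=\begin{cases}1&\text{if }w=\delta_k,\\0&\text{otherwise.}\end{cases}$$ 2. $\mathbb E[\ell(u_n\star v_n)]=\binom n2(1-o(1))$ as $n\to\infty$. 3. Let $\upsilon$ be the uniform probability measure on $[0,1]^2$. Then $\upsilon\star\upsilon$ exists, is unique, and is the anti-diagonal permuton, i.e. the distribution of $(T,1-T)$ for $T$ uniform on $[0,1]$. -/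

import Mathlib

open MeasureTheory ProbabilityTheory Filter Topology
open scoped unitInterval ENNReal Nat

namespace DemazurePermuton

/-! ### Permutations and the Demazure product

The symmetric group on `n` letters is `Equiv.Perm (Fin n)`; the letters are `0, …, n - 1`
instead of `1, …, n`, and products are compositions of functions. -/

/-- The symmetric group is a finite set: every subset is an event. -/
instance permMeasurableSpace (n : ℕ) : MeasurableSpace (Equiv.Perm (Fin n)) := ⊤

/-- The number `ℓ(v)` of inversions of `v`: pairs `a < b` with `v⁻¹(a) > v⁻¹(b)`. -/
def inversions {n : ℕ} (v : Equiv.Perm (Fin n)) : ℕ :=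
  (Finset.univ.filter fun p : Fin n × Fin n => p.1 < p.2 ∧ v⁻¹ p.2 < v⁻¹ p.1).card

/-- The adjacent transposition `s_i`, exchanging the letters `i` and `i + 1`. -/
def simpleTransposition {n : ℕ} (i : Fin (n - 1)) : Equiv.Perm (Fin n) :=
  Equiv.swap ⟨i.1, by omega⟩ ⟨i.1 + 1, by omega⟩

/-- The operator `τ_i`: it sends `u` to `u s_i` if this increases the number of inversions, and
fixes `u` otherwise. -/
def tau {n : ℕ} (i : Fin (n - 1)) (u : Equiv.Perm (Fin n)) : Equiv.Perm (Fin n) :=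
  if inversions u < inversions (u * simpleTransposition i) then u * simpleTransposition i else u

/-- The word `(i₁, …, i_r)` represents the permutation `s_{i₁} ⋯ s_{i_r}`. -/
def Represents {n : ℕ} (w : List (Fin (n - 1))) (v : Equiv.Perm (Fin n)) : Prop :=
  (w.map simpleTransposition).prod = v

/-- A word is reduced for `v` if it represents `v` and has minimum length among the words
representing `v`. -/
def IsReducedWord {n : ℕ} (w : List (Fin (n - 1))) (v : Equiv.Perm (Fin n)) : Prop :=
  Represents w v ∧ ∀ w' : List (Fin (n - 1)), Represents w' v → w.length ≤ w'.length

theorem exists_represents {n : ℕ} (v : Equiv.Perm (Fin n)) :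
    ∃ w : List (Fin (n - 1)), Represents w v := by
  rcases n with _ | n
  · exact ⟨[], Subsingleton.elim _ _⟩
  · have hv : v ∈ Submonoid.closure
        (Set.range fun i : Fin n => Equiv.swap i.castSucc i.succ) := by
      rw [Equiv.Perm.mclosure_swap_castSucc_succ]
      trivial
    induction hv using Submonoid.closure_induction with
    | mem x hx =>
      obtain ⟨i, rfl⟩ := hx
      refine ⟨[i], ?_⟩
      simp only [Represents, List.map_cons, List.map_nil, List.prod_cons, List.prod_nil, mul_one]
      rfl
    | one => exact ⟨[], rfl⟩
    | mul x y _ _ hx hy =>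
      obtain ⟨a, ha⟩ := hx
      obtain ⟨b, hb⟩ := hy
      refine ⟨a ++ b, ?_⟩
      simp only [Represents, List.map_append, List.prod_append] at *
      rw [ha, hb]

theorem exists_isReducedWord {n : ℕ} (v : Equiv.Perm (Fin n)) :
    ∃ w : List (Fin (n - 1)), IsReducedWord w v := by
  classical
  have h : ∃ m : ℕ, ∃ w : List (Fin (n - 1)), Represents w v ∧ w.length = m := by
    obtain ⟨w, hw⟩ := exists_represents v
    exact ⟨_, w, hw, rfl⟩
  obtain ⟨w, hw, hl⟩ := Nat.find_spec h
  exact ⟨w, hw, fun w' hw' => hl ▸ Nat.find_min' h ⟨w', hw', rfl⟩⟩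

/-- A reduced word for `v`. -/
noncomputable def reducedWord {n : ℕ} (v : Equiv.Perm (Fin n)) : List (Fin (n - 1)) :=
  (exists_isReducedWord v).choose

/-- The Demazure product `u ⋆ v`: if `(i₁, …, i_r)` is a reduced word for `v`, then
`u ⋆ v = u ⋆ s_{i₁} ⋆ ⋯ ⋆ s_{i_r} = τ_{i_r}(⋯ τ_{i₁}(u) ⋯)`. -/
noncomputable def demazure {n : ℕ} (u v : Equiv.Perm (Fin n)) : Equiv.Perm (Fin n) :=
  (reducedWord v).foldl (fun x i => tau i x) u

/-! ### Patterns -/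

open Classical in
/-- The number of pattern occurrences of `w` in `u`: tuples `f(1) < ⋯ < f(k)` of positions such
that `u(f(1)), …, u(f(k))` has the same relative order as `w(1), …, w(k)`. -/
noncomputable def patternCount {k n : ℕ} (w : Equiv.Perm (Fin k)) (u : Equiv.Perm (Fin n)) : ℕ :=
  (Finset.univ.filter fun f : Fin k → Fin n =>
    StrictMono f ∧ ∀ a b : Fin k, u (f a) < u (f b) ↔ w a < w b).card

/-- The density of the pattern `w` (of size `k`) in `u` (of size `n ≥ k`). -/
noncomputable def patternDensity {k n : ℕ} (w : Equiv.Perm (Fin k)) (u : Equiv.Perm (Fin n)) : ℝ :=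
  (patternCount w u : ℝ) / (n.choose k : ℝ)

/-! ### Permutons -/

/-- A permuton is a probability measure on the unit square with uniform marginals. -/
structure IsPermuton (μ : Measure (I × I)) : Prop where
  isProbabilityMeasure : IsProbabilityMeasure μ
  snd_uniform : ∀ a b : I, a ≤ b → μ (Set.univ ×ˢ Set.Icc a b) = ENNReal.ofReal (b - a)
  fst_uniform : ∀ a b : I, a ≤ b → μ (Set.Icc a b ×ˢ Set.univ) = ENNReal.ofReal (b - a)

/-- The height function `H_μ(x, y) = μ([x, 1] × [0, y])`. -/
noncomputable def height (μ : Measure (I × I)) (x y : I) : ℝ :=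
  μ.real (Set.Icc x 1 ×ˢ Set.Icc 0 y)

/-- `ρ` is the Demazure product `μ ⋆ ν` of the permutons `μ` and `ν`: it is a permuton, and
`H_ρ(x, y) = min_γ (H_μ(γ, y) + H_ν(x, γ))` for all `x`, `y`. -/
def IsDemazureProduct (μ ν ρ : Measure (I × I)) : Prop :=
  IsPermuton ρ ∧ ∀ x y : I,
    IsLeast (Set.range fun γ : I => height μ γ y + height ν x γ) (height ρ x y)

/-- The uniform permuton `υ`: Lebesgue measure on the unit square. -/
noncomputable def uniformPermuton : Measure (I × I) := volume

/-- The anti-diagonal permuton: the distribution of `(t, 1 - t)` for `t` uniform in `[0, 1]`. -/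
noncomputable def antiDiagonalPermuton : Measure (I × I) :=
  (volume : Measure I).map fun t => (t, unitInterval.symm t)

end DemazurePermuton

namespace DemazurePermuton

/-! ### Corner counts and the Demazure product -/

/-! The discrete height function `cornerCount` of `u ⋆ v` obeys the same min-plus formula as
permutons. Only one half is needed: for all `x`, `y` some `g` gives `H_u(g, y) + H_v(x, g) ≤
H_{u⋆v}(x, y)` (`exists_cornerCount_add_le_demazure`).

For uniform `u`, `v`, all heights are at least `(n - x) y / n - ε n`, except with probability
exponentially small in `n` (`card_not_isSpread_le`, a Chernoff bound for sampling without
replacement). At `y = n - x` the two main terms add up to `n - x` whatever `g` is, so `H_{u⋆v}(x, n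
- x)` is within `2 ε n` of its maximum. Thus `u ⋆ v` lies close to the antidiagonal and has at most
`4 ε n²` non-inversions (`nonInversions_demazure_le`).

By Borel–Cantelli the number of non-inversions is almost surely `o(n²)`. A non-decreasing `k`-tuple
contains a non-inversion, so such tuples have vanishing density; dominated convergence gives the
expected length. For the uniform permuton the function minimised over `γ` is affine, so its minimum
is at an endpoint, and it is the height of the antidiagonal. -/

/-- The number of positions `p ≥ x` with `w(p) < y`, a discrete height function. -/
def cornerCount {n : ℕ} (w : Equiv.Perm (Fin n)) (x y : ℕ) : ℕ :=
  (Finset.univ.filter fun p : Fin n => x ≤ p.1 ∧ (w p).1 < y).card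

/-- Inversions are indexed by pairs of values, and `s_i` keeps the order of every pair of positions
other than `(i, i + 1)`. So the inversion set only grows, and gains the pair of values at these two
positions. -/
theorem inversions_lt_mul_simpleTransposition {n : ℕ} (w : Equiv.Perm (Fin n)) (i : Fin (n - 1))
    (h : w ⟨i.1, by omega⟩ < w ⟨i.1 + 1, by omega⟩) :
    inversions w < inversions (w * simpleTransposition i) := by
  have key : ∀ p q : Fin n, p < q → ¬ (p.1 = i.1 ∧ q.1 = i.1 + 1) →
      simpleTransposition i p < simpleTransposition i q := by
    intro p q hpq hne
    simp only [simpleTransposition, Equiv.swap_apply_def, Fin.ext_iff, Fin.lt_def] at *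
    split_ifs <;> (try dsimp only) <;> omega
  have hinv : (simpleTransposition i)⁻¹ = simpleTransposition i := by
    simp [simpleTransposition]
  unfold inversions
  apply Finset.card_lt_card
  rw [Finset.ssubset_iff_of_subset]
  · refine ⟨(w ⟨i.1, by omega⟩, w ⟨i.1 + 1, by omega⟩), ?_, ?_⟩
    · simp [mul_inv_rev, hinv, h]
      simp [simpleTransposition]
    · simp
  · rintro ⟨a, b⟩ hab
    simp only [Finset.mem_filter, Finset.mem_univ, true_and] at hab ⊢
    refine ⟨hab.1, ?_⟩
    rw [mul_inv_rev, hinv]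
    apply key _ _ hab.2
    rintro ⟨h1, h2⟩
    have e1 : w⁻¹ b = ⟨i.1, by omega⟩ := Fin.ext h1
    have e2 : w⁻¹ a = ⟨i.1 + 1, by omega⟩ := Fin.ext h2
    rw [Equiv.Perm.inv_eq_iff_eq] at e1 e2
    rw [← e1, ← e2] at h
    exact absurd hab.1 (not_lt.mpr h.le)

theorem tau_eq {n : ℕ} (i : Fin (n - 1)) (w : Equiv.Perm (Fin n)) :
    tau i w = if w ⟨i.1, by omega⟩ < w ⟨i.1 + 1, by omega⟩ then w * simpleTransposition i
      else w := by
  unfold tau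
  by_cases h : w ⟨i.1, by omega⟩ < w ⟨i.1 + 1, by omega⟩
  · rw [if_pos h, if_pos (inversions_lt_mul_simpleTransposition w i h)]
  · have h2 : (w * simpleTransposition i) ⟨i.1, by omega⟩
        < (w * simpleTransposition i) ⟨i.1 + 1, by omega⟩ := by
      simp only [simpleTransposition, Equiv.Perm.mul_apply, Equiv.swap_apply_left,
        Equiv.swap_apply_right]
      refine lt_of_le_of_ne (not_lt.mp h) fun e => ?_
      have := congrArg Fin.val (w.injective e)
      simp at this
    have h3 := inversions_lt_mul_simpleTransposition _ i h2
    have h4 : w * simpleTransposition i * simpleTransposition i = w := by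
      simp [mul_assoc, simpleTransposition]
    rw [h4] at h3
    rw [if_neg h, if_neg (not_lt.mpr h3.le)]

theorem cornerCount_succ {n : ℕ} (w : Equiv.Perm (Fin n)) (x y : ℕ) (hx : x < n) :
    cornerCount w x y = cornerCount w (x + 1) y + if (w ⟨x, hx⟩).1 < y then 1 else 0 := by
  unfold cornerCount
  split_ifs with h
  · rw [← Finset.card_insert_of_notMem (a := ⟨x, hx⟩) (by simp)]
    refine congrArg Finset.card ?_
    ext p
    simp only [Finset.mem_filter, Finset.mem_univ, true_and, Finset.mem_insert]
    constructor
    · rintro ⟨h1, h2⟩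
      by_cases hp : p.1 = x
      · exact Or.inl (Fin.ext hp)
      · exact Or.inr ⟨by omega, h2⟩
    · rintro (rfl | ⟨h1, h2⟩)
      · exact ⟨le_refl _, h⟩
      · exact ⟨by omega, h2⟩
  · rw [add_zero]
    refine congrArg Finset.card ?_
    ext p
    simp only [Finset.mem_filter, Finset.mem_univ, true_and]
    constructor
    · rintro ⟨h1, h2⟩
      refine ⟨lt_of_le_of_ne h1 ?_, h2⟩
      rintro rfl
      exact h h2
    · rintro ⟨h1, h2⟩
      exact ⟨by omega, h2⟩

/-- Only the threshold `i + 1` separates the positions `i` and `i + 1`. -/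
theorem cornerCount_mul_simpleTransposition {n : ℕ} (w : Equiv.Perm (Fin n)) (i : Fin (n - 1))
    (x y : ℕ) (hx : x ≠ i.1 + 1) :
    cornerCount (w * simpleTransposition i) x y = cornerCount w x y := by
  unfold cornerCount
  have key : ∀ p : Fin n, x ≤ p.1 → x ≤ (simpleTransposition i p).1 := by
    intro p hp
    simp only [simpleTransposition, Equiv.swap_apply_def, Fin.ext_iff]
    split_ifs <;> (try dsimp only) <;> omega
  refine Finset.card_bij' (fun p _ => simpleTransposition i p)
    (fun p _ => simpleTransposition i p) (fun p hp => ?_) (fun p hp => ?_) ?_ ?_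
  · have h := (Finset.mem_filter.mp hp).2
    exact Finset.mem_filter.mpr ⟨Finset.mem_univ _, key p h.1, h.2⟩
  · have h := (Finset.mem_filter.mp hp).2
    refine Finset.mem_filter.mpr ⟨Finset.mem_univ _, key p h.1, ?_⟩
    simpa [simpleTransposition] using h.2
  · simp [simpleTransposition]
  · simp [simpleTransposition]

theorem cornerCount_tau_of_ne {n : ℕ} (w : Equiv.Perm (Fin n)) (i : Fin (n - 1))
    (x y : ℕ) (hx : x ≠ i.1 + 1) :
    cornerCount (tau i w) x y = cornerCount w x y := by
  unfold tau
  split_ifs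
  · exact cornerCount_mul_simpleTransposition w i x y hx
  · rfl

/-- After `τ_i` the smaller of the two values sits at `i + 1`. If it is below `y`, the count at `i +
1` exceeds that at `i + 2` by one; if not, neither value is below `y` and the count equals that at
`i`. -/
theorem le_cornerCount_tau {n : ℕ} (w : Equiv.Perm (Fin n)) (i : Fin (n - 1)) (y : ℕ) :
    min (cornerCount w i.1 y) (cornerCount w (i.1 + 2) y + 1) ≤
      cornerCount (tau i w) (i.1 + 1) y := by
  have hd : (tau i w) ⟨i.1 + 1, by omega⟩ ≤ (tau i w) ⟨i.1, by omega⟩ := by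
    rw [tau_eq]
    split_ifs with h
    · simpa [simpleTransposition] using h.le
    · exact not_lt.mp h
  rw [← cornerCount_tau_of_ne w i i.1 y (by omega),
    ← cornerCount_tau_of_ne w i (i.1 + 2) y (by omega)]
  rw [cornerCount_succ (tau i w) i.1 y (by omega),
    cornerCount_succ (tau i w) (i.1 + 1) y (by omega), show i.1 + 1 + 1 = i.1 + 2 from rfl]
  rw [Fin.le_def] at hd
  split_ifs <;> omega

theorem cornerCount_mul_simpleTransposition_le {n : ℕ} (w : Equiv.Perm (Fin n)) (i : Fin (n - 1))
    (y : ℕ) :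
    cornerCount (w * simpleTransposition i) (i.1 + 1) y ≤
      min (cornerCount w i.1 y) (cornerCount w (i.1 + 2) y + 1) := by
  rw [← cornerCount_mul_simpleTransposition w i i.1 y (by omega),
    ← cornerCount_mul_simpleTransposition w i (i.1 + 2) y (by omega)]
  rw [cornerCount_succ (w * simpleTransposition i) i.1 y (by omega),
    cornerCount_succ (w * simpleTransposition i) (i.1 + 1) y (by omega),
    show i.1 + 1 + 1 = i.1 + 2 from rfl]
  split_ifs <;> omega

/-- Induction on the last letter `i`. At `x = i + 1` the count of the Demazure side is at least a
minimum over the neighbours `i` and `i + 2`, while that of the ordinary product is at most the same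
expression. The `g` of the neighbour attaining the minimum therefore still works. Reducedness plays
no role. -/
theorem exists_cornerCount_add_le_foldl_tau {n : ℕ} (u : Equiv.Perm (Fin n))
    (l : List (Fin (n - 1))) :
    ∀ x y : ℕ, x ≤ n → ∃ g ≤ n,
      cornerCount u g y + cornerCount (l.map simpleTransposition).prod x g ≤
        cornerCount (l.foldl (fun a i => tau i a) u) x y := by
  induction l using List.reverseRecOn with
  | nil =>
    intro x y hx
    -- For the empty word `g = x` works: the identity has no position `≥ x` with value `< x`.
    refine ⟨x, hx, ?_⟩
    have h : cornerCount (1 : Equiv.Perm (Fin n)) x x = 0 := by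
      simp only [cornerCount, Equiv.Perm.one_apply, Finset.card_eq_zero]
      exact Finset.filter_eq_empty_iff.mpr fun p _ => by omega
    simp [h]
  | append_singleton l i ih =>
    intro x y hx
    simp only [List.map_append, List.map_cons, List.map_nil, List.prod_append, List.prod_cons,
      List.prod_nil, mul_one, List.foldl_append, List.foldl_cons, List.foldl_nil]
    by_cases hxi : x = i.1 + 1
    · subst hxi
      have h1 := le_cornerCount_tau (l.foldl (fun a i => tau i a) u) i y
      rcases le_total (cornerCount (l.foldl (fun a i => tau i a) u) i.1 y)
        (cornerCount (l.foldl (fun a i => tau i a) u) (i.1 + 2) y + 1) with h | h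
      · obtain ⟨g, hg, hle⟩ := ih i.1 y (by omega)
        have h2 := cornerCount_mul_simpleTransposition_le (l.map simpleTransposition).prod i g
        exact ⟨g, hg, by omega⟩
      · obtain ⟨g, hg, hle⟩ := ih (i.1 + 2) y (by omega)
        have h2 := cornerCount_mul_simpleTransposition_le (l.map simpleTransposition).prod i g
        exact ⟨g, hg, by omega⟩
    · obtain ⟨g, hg, hle⟩ := ih x y hx
      refine ⟨g, hg, ?_⟩
      rwa [cornerCount_mul_simpleTransposition _ i x g hxi, cornerCount_tau_of_ne _ i x y hxi]

theorem exists_cornerCount_add_le_demazure {n : ℕ} (u v : Equiv.Perm (Fin n)) (x y : ℕ)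
    (hx : x ≤ n) :
    ∃ g ≤ n, cornerCount u g y + cornerCount v x g ≤ cornerCount (demazure u v) x y := by
  have h := exists_cornerCount_add_le_foldl_tau u (reducedWord v) x y hx
  have hv : Represents (reducedWord v) v := (exists_isReducedWord v).choose_spec.1
  unfold Represents at hv
  rwa [hv] at h

/-! ### Non-inversions -/

/-- The number of pairs of positions `p < q` with `w(p) < w(q)`. -/
def nonInversions {n : ℕ} (w : Equiv.Perm (Fin n)) : ℕ :=
  (Finset.univ.filter fun p : Fin n × Fin n => p.1 < p.2 ∧ w p.1 < w p.2).card

theorem card_filter_le_val {n x : ℕ} :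
    (Finset.univ.filter fun p : Fin n => x ≤ p.1).card = n - x := by
  have := Fin.card_filter_val_lt (n := n) (m := x)
  have h2 := Finset.card_filter_add_card_filter_not (s := (Finset.univ : Finset (Fin n)))
    (fun p => p.1 < x)
  simp only [not_lt, Finset.card_univ, Fintype.card_fin] at h2
  omega

theorem card_filter_perm_lt {n : ℕ} (w : Equiv.Perm (Fin n)) {y : ℕ} (hy : y ≤ n) :
    (Finset.univ.filter fun p : Fin n => (w p).1 < y).card = y := by
  have := Fin.card_filter_val_lt (n := n) (m := y)
  rw [min_eq_right hy] at this
  refine Eq.trans ?_ this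
  exact Finset.card_bij' (fun p _ => w p) (fun p _ => w⁻¹ p) (by simp) (by simp) (by simp)
    (by simp)

theorem cornerCount_add_card_le {n : ℕ} (w : Equiv.Perm (Fin n)) (x y : ℕ) :
    cornerCount w x y + (Finset.univ.filter fun p : Fin n => x ≤ p.1 ∧ y ≤ (w p).1).card
      = n - x := by
  rw [← card_filter_le_val (n := n) (x := x),
    ← Finset.card_filter_add_card_filter_not (s := Finset.univ.filter fun p : Fin n => x ≤ p.1)
    (fun p => (w p).1 < y)]
  simp only [Finset.filter_filter, not_lt, cornerCount]

theorem cornerCount_add_card_lt {n : ℕ} (w : Equiv.Perm (Fin n)) (x y : ℕ) (hy : y ≤ n) :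
    cornerCount w x y + (Finset.univ.filter fun p : Fin n => p.1 < x ∧ (w p).1 < y).card = y := by
  conv_rhs => rw [← card_filter_perm_lt w hy]
  rw [← Finset.card_filter_add_card_filter_not
    (s := Finset.univ.filter fun p : Fin n => (w p).1 < y) (fun p => x ≤ p.1)]
  simp only [Finset.filter_filter, not_le, cornerCount, and_comm]

/-- The hypothesis leaves at most `K` points in each quadrant strictly beyond or below an
antidiagonal corner. For a non-inversion `p < q`, if `p + 1 + w q ≥ n` then `q` is one of the `K`
exceptions at the corner determined by `p`; otherwise `p` is one at the corner determined by `w q`.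
-/
theorem nonInversions_le_of_cornerCount {n K : ℕ} (w : Equiv.Perm (Fin n))
    (h : ∀ x ≤ n, n - x ≤ cornerCount w x (n - x) + K) :
    nonInversions w ≤ 2 * (n * K) := by
  let A : Finset (Fin n × Fin n) := Finset.univ.filter fun p =>
    p.1.1 + 1 ≤ p.2.1 ∧ n - (p.1.1 + 1) ≤ (w p.2).1
  let B : Finset (Fin n × Fin n) := Finset.univ.filter fun p =>
    p.1.1 < n - (w p.2).1 ∧ (w p.1).1 < n - (n - (w p.2).1)
  have hsub : (Finset.univ.filter fun p : Fin n × Fin n => p.1 < p.2 ∧ w p.1 < w p.2) ⊆ A ∪ B := by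
    rintro ⟨p, q⟩ hpq
    simp only [Finset.mem_filter, Finset.mem_univ, true_and, Finset.mem_union, A, B,
      Fin.lt_def] at hpq ⊢
    omega
  have hA : A.card ≤ n * K := by
    have : A.card = ∑ p : Fin n, (Finset.univ.filter fun q : Fin n =>
        p.1 + 1 ≤ q.1 ∧ n - (p.1 + 1) ≤ (w q).1).card := by
      simp only [A, Finset.card_filter, Fintype.sum_prod_type]
    rw [this]
    calc _ ≤ ∑ _p : Fin n, K := Finset.sum_le_sum fun p _ => by
            have h1 := h (p.1 + 1) (by omega)
            have h2 := cornerCount_add_card_le w (p.1 + 1) (n - (p.1 + 1))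
            omega
      _ = n * K := by simp
  have hB : B.card ≤ n * K := by
    have : B.card = ∑ q : Fin n, (Finset.univ.filter fun p : Fin n =>
        p.1 < n - (w q).1 ∧ (w p).1 < n - (n - (w q).1)).card := by
      simp only [B, Finset.card_filter, Fintype.sum_prod_type_right]
    rw [this]
    calc _ ≤ ∑ _p : Fin n, K := Finset.sum_le_sum fun q _ => by
            have h1 := h (n - (w q).1) (by omega)
            have h2 := cornerCount_add_card_lt w (n - (w q).1) (n - (n - (w q).1)) (by omega)
            omega
      _ = n * K := by simp
  calc nonInversions w ≤ (A ∪ B).card := Finset.card_le_card hsub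
    _ ≤ A.card + B.card := Finset.card_union_le _ _
    _ ≤ 2 * (n * K) := by omega

theorem card_filter_fst_lt_snd (n : ℕ) :
    (Finset.univ.filter fun p : Fin n × Fin n => p.1 < p.2).card = n.choose 2 := by
  have h : (Finset.univ.filter fun p : Fin n × Fin n => p.1 < p.2).card
      = ∑ q : Fin n, q.1 := by
    simp only [Finset.card_filter, Fintype.sum_prod_type_right]
    refine Finset.sum_congr rfl fun q _ => ?_
    rw [← Finset.card_filter, ← Fin.card_Iio q]
    exact congrArg Finset.card (by ext p; simp)
  rw [h, Fin.sum_univ_eq_sum_range (fun i => i), Finset.sum_range_id, Nat.choose_two_right]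

theorem inversions_add_nonInversions {n : ℕ} (w : Equiv.Perm (Fin n)) :
    inversions w + nonInversions w = n.choose 2 := by
  have h1 : nonInversions w = (Finset.univ.filter fun p : Fin n × Fin n =>
      p.1 < p.2 ∧ ¬ w⁻¹ p.2 < w⁻¹ p.1).card := by
    unfold nonInversions
    -- `inversions` is indexed by values and `nonInversions` by positions; `w` translates.
    refine Finset.card_bij' (fun p _ => (w p.1, w p.2)) (fun p _ => (w⁻¹ p.1, w⁻¹ p.2))
      (fun p h => ?_) (fun p h => ?_) (by simp) (by simp)
    · have h := (Finset.mem_filter.mp h).2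
      exact Finset.mem_filter.mpr ⟨Finset.mem_univ _, h.2, by simpa using h.1.le⟩
    · have h := (Finset.mem_filter.mp h).2
      exact Finset.mem_filter.mpr ⟨Finset.mem_univ _,
        lt_of_le_of_ne (not_lt.mp h.2) fun e => h.1.ne (w⁻¹.injective e),
        by simpa using h.1⟩
  rw [h1, ← card_filter_fst_lt_snd, ← Finset.card_filter_add_card_filter_not
    (s := Finset.univ.filter fun p : Fin n × Fin n => p.1 < p.2) (fun p => w⁻¹ p.2 < w⁻¹ p.1)]
  simp only [Finset.filter_filter, inversions]

/-! ### Concentration of corner counts of uniform permutations -/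

-- Double counting of pairs `(r, u)` with `r ∉ S` and `u` mapping `insert r S` into `B`. Composing
-- with a transposition shows that all `r` contribute equally, and each `u` mapping `S` into `B`
-- admits exactly `|B| - |S|` choices of `r`.
open Classical in
theorem card_mapsTo_insert {n : ℕ} (S B : Finset (Fin n)) (p : Fin n) (hp : p ∉ S) :
    ((n : ℝ) - S.card) *
      (Finset.univ.filter fun u : Equiv.Perm (Fin n) => ∀ q ∈ insert p S, u q ∈ B).card =
    ((B.card : ℝ) - S.card) *
      (Finset.univ.filter fun u : Equiv.Perm (Fin n) => ∀ q ∈ S, u q ∈ B).card := by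
  have hsymm : ∀ r ∈ Sᶜ,
      (Finset.univ.filter fun u : Equiv.Perm (Fin n) => ∀ q ∈ insert r S, u q ∈ B).card =
      (Finset.univ.filter fun u : Equiv.Perm (Fin n) => ∀ q ∈ insert p S, u q ∈ B).card := by
    intro r hr
    rw [Finset.mem_compl] at hr
    have key : ∀ a b : Fin n, a ∉ S → b ∉ S → ∀ u : Equiv.Perm (Fin n),
        (∀ q ∈ insert a S, u q ∈ B) → ∀ q ∈ insert b S, (u * Equiv.swap a b) q ∈ B := by
      intro a b ha hb u hu q hq
      rw [Finset.mem_insert] at hq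
      rcases hq with rfl | hq
      · simpa using hu a (Finset.mem_insert_self _ _)
      · have h1 : q ≠ a := fun e => ha (e ▸ hq)
        have h2 : q ≠ b := fun e => hb (e ▸ hq)
        rw [Equiv.Perm.mul_apply, Equiv.swap_apply_of_ne_of_ne h1 h2]
        exact hu q (Finset.mem_insert_of_mem hq)
    refine Finset.card_bij' (fun u _ => u * Equiv.swap r p) (fun u _ => u * Equiv.swap p r)
      (fun u hu => ?_) (fun u hu => ?_) ?_ ?_
    · exact Finset.mem_filter.mpr
        ⟨Finset.mem_univ _, key r p hr hp u (Finset.mem_filter.mp hu).2⟩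
    · exact Finset.mem_filter.mpr
        ⟨Finset.mem_univ _, key p r hp hr u (Finset.mem_filter.mp hu).2⟩
    · intro u _
      simp [mul_assoc, Equiv.swap_comm r p]
    · intro u _
      simp [mul_assoc, Equiv.swap_comm r p]
  have hcount : ∀ u : Equiv.Perm (Fin n), (∀ q ∈ S, u q ∈ B) →
      ((Sᶜ.filter fun r => u r ∈ B).card : ℝ) = (B.card : ℝ) - S.card := by
    intro u hu
    have h1 : (Finset.univ.filter fun r => u r ∈ B).card = B.card :=
      Finset.card_bij' (fun r _ => u r) (fun r _ => u⁻¹ r) (by simp) (by simp) (by simp)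
        (by simp)
    have h2 : Finset.univ.filter (fun r => u r ∈ B) = S ∪ Sᶜ.filter fun r => u r ∈ B := by
      ext r
      simp only [Finset.mem_filter, Finset.mem_univ, true_and, Finset.mem_union,
        Finset.mem_compl]
      have := hu r
      tauto
    have h3 : Disjoint S (Sᶜ.filter fun r => u r ∈ B) :=
      Finset.disjoint_left.mpr fun r hr hr' => by simp [hr] at hr'
    rw [h2, Finset.card_union_of_disjoint h3] at h1
    rw [← h1]
    push_cast
    ring
  have hdouble : ∑ r ∈ Sᶜ,
      (Finset.univ.filter fun u : Equiv.Perm (Fin n) => ∀ q ∈ insert r S, u q ∈ B).card =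
      ∑ u ∈ Finset.univ.filter (fun u : Equiv.Perm (Fin n) => ∀ q ∈ S, u q ∈ B),
        (Sᶜ.filter fun r => u r ∈ B).card := by
    simp only [Finset.card_filter]
    rw [Finset.sum_comm, Finset.sum_filter]
    refine Finset.sum_congr rfl fun u _ => ?_
    split_ifs with h
    · refine Finset.sum_congr rfl fun r _ => ?_
      exact if_congr (by rw [Finset.forall_mem_insert]; exact and_iff_left h) rfl rfl
    · refine Finset.sum_eq_zero fun r _ => if_neg fun h' => h fun q hq =>
        h' q (Finset.mem_insert_of_mem hq)
  rw [Finset.sum_congr rfl hsymm, Finset.sum_const, smul_eq_mul, Finset.card_compl,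
    Fintype.card_fin] at hdouble
  have hd := congrArg (Nat.cast : ℕ → ℝ) hdouble
  rw [Nat.cast_mul, Nat.cast_sub (by simpa using Finset.card_le_univ S), Nat.cast_sum,
    Finset.sum_congr rfl (fun u hu => hcount u (Finset.mem_filter.mp hu).2), Finset.sum_const,
    nsmul_eq_mul] at hd
  rw [hd, mul_comm]

open Classical in
theorem card_mapsTo_le {n : ℕ} (S B : Finset (Fin n)) :
    ((Finset.univ.filter fun u : Equiv.Perm (Fin n) => ∀ q ∈ S, u q ∈ B).card : ℝ) ≤
      n ! * ((B.card : ℝ) / n) ^ S.card := by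
  induction S using Finset.induction_on with
  | empty => simp [Fintype.card_perm]
  | insert p S hp ih =>
    have h := card_mapsTo_insert S B p hp
    have hS : (S.card : ℝ) < n := by
      have := Finset.card_lt_univ_of_notMem hp
      rw [Fintype.card_fin] at this
      exact_mod_cast this
    have hB : (B.card : ℝ) ≤ n := by
      have := Finset.card_le_univ B
      rw [Fintype.card_fin] at this
      exact_mod_cast this
    have hn : (0 : ℝ) < n := lt_of_le_of_lt (Nat.cast_nonneg _) hS
    rw [Finset.card_insert_of_notMem hp, pow_succ, ← mul_assoc]
    set X : ℝ :=
      ((Finset.univ.filter fun u : Equiv.Perm (Fin n) => ∀ q ∈ insert p S, u q ∈ B).card : ℝ)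
    set Y : ℝ := ((Finset.univ.filter fun u : Equiv.Perm (Fin n) => ∀ q ∈ S, u q ∈ B).card : ℝ)
    have hY : 0 ≤ Y := Nat.cast_nonneg _
    have h1 : X ≤ Y * (B.card / n) := by
      rw [← mul_div_assoc, le_div_iff₀ hn]
      have h2 : ((n : ℝ) - S.card) * (X * n) ≤ ((n : ℝ) - S.card) * (Y * B.card) := by
        -- Sampling without replacement: `(|B| - |S|) / (n - |S|) ≤ |B| / n`.
        have : ((B.card : ℝ) - S.card) * n ≤ ((n : ℝ) - S.card) * B.card := by
          nlinarith [mul_le_mul_of_nonneg_left hB (Nat.cast_nonneg (α := ℝ) S.card)]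
        calc ((n : ℝ) - S.card) * (X * n) = (((B.card : ℝ) - S.card) * n) * Y := by
              rw [← mul_assoc, h]; ring
          _ ≤ (((n : ℝ) - S.card) * B.card) * Y := mul_le_mul_of_nonneg_right this hY
          _ = _ := by ring
      exact le_of_mul_le_mul_left h2 (by linarith)
    exact h1.trans (mul_le_mul_of_nonneg_right ih (by positivity))

/-- Expanding `∏ (1 + (e^s - 1) 1[u p ∈ B])` over subsets of `A` has nonnegative coefficients, so
`card_mapsTo_le` bounds it by the binomial moment generating function. -/
theorem sum_exp_card_le {n : ℕ} (A B : Finset (Fin n)) {s : ℝ} (hs : 0 ≤ s) :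
    ∑ u : Equiv.Perm (Fin n), Real.exp (s * (A.filter fun p => u p ∈ B).card) ≤
      n ! * (1 + (Real.exp s - 1) * ((B.card : ℝ) / n)) ^ A.card := by
  classical
  have ht : 0 ≤ Real.exp s - 1 := by linarith [Real.add_one_le_exp s]
  have hexp : ∀ u : Equiv.Perm (Fin n), Real.exp (s * (A.filter fun p => u p ∈ B).card) =
      ∑ S ∈ A.powerset, (Real.exp s - 1) ^ S.card * if ∀ q ∈ S, u q ∈ B then 1 else 0 := by
    intro u
    have h1 : Real.exp (s * (A.filter fun p => u p ∈ B).card) =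
        ∏ p ∈ A, (1 + (Real.exp s - 1) * if u p ∈ B then 1 else 0) := by
      have : ∀ p ∈ A, (1 + (Real.exp s - 1) * if u p ∈ B then (1 : ℝ) else 0) =
          if u p ∈ B then Real.exp s else 1 := by
        intro p _
        split_ifs <;> ring
      rw [Finset.prod_congr rfl this, Finset.prod_ite, Finset.prod_const, Finset.prod_const_one,
        mul_one, ← Real.exp_nat_mul, mul_comm]
    rw [h1, Finset.prod_one_add]
    refine Finset.sum_congr rfl fun S _ => ?_
    rw [Finset.prod_mul_distrib, Finset.prod_const]
    congr 1
    rw [Finset.prod_ite_zero]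
    simp
  rw [Finset.sum_congr rfl fun u _ => hexp u, Finset.sum_comm]
  calc _ ≤ ∑ S ∈ A.powerset, (n ! : ℝ) * ((Real.exp s - 1) * ((B.card : ℝ) / n)) ^ S.card := by
        refine Finset.sum_le_sum fun S _ => ?_
        rw [← Finset.mul_sum, Finset.sum_boole, mul_pow, mul_left_comm]
        exact mul_le_mul_of_nonneg_left (card_mapsTo_le S B) (pow_nonneg ht _)
    _ = _ := by
        rw [← Finset.mul_sum]
        congr 1
        have := Finset.prod_one_add (f := fun _ => (Real.exp s - 1) * ((B.card : ℝ) / n)) A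
        rw [Finset.prod_const] at this
        rw [this]
        simp only [Finset.prod_const]

open Classical in
theorem card_large_intersection_le {n : ℕ} (A B : Finset (Fin n)) {ε : ℝ} (hε : 0 ≤ ε)
    (hε2 : ε ≤ 2) :
    ((Finset.univ.filter fun u : Equiv.Perm (Fin n) =>
        (A.card : ℝ) * B.card / n + ε * n ≤ (A.filter fun p => u p ∈ B).card).card : ℝ) ≤
      n ! * Real.exp (-(ε ^ 2 / 4) * n) := by
  -- This minimises the Chernoff exponent `(s² - s ε) n`; `ε ≤ 2` ensures `s ≤ 1`, needed for `e^s -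
  -- 1 ≤ s + s²`.
  set s : ℝ := ε / 2
  have hs0 : 0 ≤ s := by positivity
  have hs1 : s ≤ 1 := by simp only [s]; linarith
  set m : ℝ := (A.card : ℝ) * B.card / n + ε * n
  set E := Finset.univ.filter fun u : Equiv.Perm (Fin n) =>
        m ≤ (A.filter fun p => u p ∈ B).card
  have hmarkov : (E.card : ℝ) * Real.exp (s * m) ≤
      ∑ u : Equiv.Perm (Fin n), Real.exp (s * (A.filter fun p => u p ∈ B).card) := by
    rw [← nsmul_eq_mul, ← Finset.sum_const]
    calc _ ≤ ∑ u ∈ E, Real.exp (s * (A.filter fun p => u p ∈ B).card) := by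
          refine Finset.sum_le_sum fun u hu => Real.exp_le_exp.mpr ?_
          exact mul_le_mul_of_nonneg_left (Finset.mem_filter.mp hu).2 hs0
      _ ≤ _ := Finset.sum_le_sum_of_subset_of_nonneg (Finset.subset_univ _)
          fun _ _ _ => (Real.exp_pos _).le
  have hA : (A.card : ℝ) ≤ n := by
    have := Finset.card_le_univ A
    rw [Fintype.card_fin] at this
    exact_mod_cast this
  have hB : (B.card : ℝ) ≤ n := by
    have := Finset.card_le_univ B
    rw [Fintype.card_fin] at this
    exact_mod_cast this
  have hab : (A.card : ℝ) * (B.card / n) ≤ n := by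
    have h1 : (B.card : ℝ) / n ≤ 1 := div_le_one_of_le₀ hB (Nat.cast_nonneg _)
    calc (A.card : ℝ) * (B.card / n) ≤ n * 1 :=
          mul_le_mul hA h1 (by positivity) (Nat.cast_nonneg _)
      _ = n := mul_one _
  have hmgf := sum_exp_card_le A B hs0
  have hpow : (1 + (Real.exp s - 1) * ((B.card : ℝ) / n)) ^ A.card ≤
      Real.exp ((s + s ^ 2) * (A.card * (B.card / n))) := by
    have h1 : Real.exp s - 1 ≤ s + s ^ 2 := by
      have := Real.abs_exp_sub_one_sub_id_le (x := s) (by rwa [abs_of_nonneg hs0])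
      linarith [(abs_le.mp this).2]
    have h0 : 0 ≤ Real.exp s - 1 := by linarith [Real.add_one_le_exp s]
    calc _ ≤ (Real.exp ((s + s ^ 2) * (B.card / n))) ^ A.card := by
          refine pow_le_pow_left₀ (by positivity) ?_ _
          have h2 := Real.add_one_le_exp ((s + s ^ 2) * ((B.card : ℝ) / n))
          have h3 := mul_le_mul_of_nonneg_right h1 (show (0 : ℝ) ≤ (B.card : ℝ) / n by positivity)
          linarith
      _ = _ := by rw [← Real.exp_nat_mul]; ring_nf
  have hE : (E.card : ℝ) ≤
      n ! * Real.exp ((s + s ^ 2) * (A.card * (B.card / n))) * Real.exp (-(s * m)) := by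
    have h1 := hmarkov.trans (hmgf.trans (mul_le_mul_of_nonneg_left hpow (Nat.cast_nonneg _)))
    have h2 := mul_le_mul_of_nonneg_right h1 (Real.exp_pos (-(s * m))).le
    rwa [mul_assoc, ← Real.exp_add, add_neg_cancel, Real.exp_zero, mul_one] at h2
  refine hE.trans ?_
  rw [mul_assoc, ← Real.exp_add]
  refine mul_le_mul_of_nonneg_left (Real.exp_le_exp.mpr ?_) (Nat.cast_nonneg _)
  have h4 : s ^ 2 * (A.card * ((B.card : ℝ) / n)) ≤ s ^ 2 * n :=
    mul_le_mul_of_nonneg_left hab (by positivity)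
  have h5 : s * m = s * (A.card * (B.card / n)) + s * ε * n := by simp only [m]; ring
  have h6 : s ^ 2 * (n : ℝ) - s * ε * n = -(ε ^ 2 / 4) * n := by simp only [s]; ring
  rw [h5]
  linarith

/-- The corner counts of `w` are at least those of the uniform measure, up to `ε n`. -/
def IsSpread {n : ℕ} (ε : ℝ) (w : Equiv.Perm (Fin n)) : Prop :=
  ∀ x ≤ n, ∀ y ≤ n, ((n : ℝ) - x) * y / n - ε * n ≤ cornerCount w x y

-- A deficit of points with value `< y` among positions `≥ x` is an excess of points with value `≥
-- y`, so the upper tail suffices. The union bound runs over `(n + 1)²` corners.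
open Classical in
theorem card_not_isSpread_le {n : ℕ} {ε : ℝ} (hε : 0 ≤ ε) (hε2 : ε ≤ 2) :
    ((Finset.univ.filter fun u : Equiv.Perm (Fin n) => ¬ IsSpread ε u).card : ℝ) ≤
      ((n : ℝ) + 1) ^ 2 * (n ! * Real.exp (-(ε ^ 2 / 4) * n)) := by
  rcases Nat.eq_zero_or_pos n with rfl | hn
  · have : (Finset.univ.filter fun u : Equiv.Perm (Fin 0) => ¬ IsSpread ε u) = ∅ := by
      refine Finset.filter_eq_empty_iff.mpr fun u _ => ?_
      rw [not_not]
      intro x hx y hy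
      simp
    rw [this]
    simp
  have hn' : (0 : ℝ) < n := by exact_mod_cast hn
  let A : ℕ → Finset (Fin n) := fun x => Finset.univ.filter fun p => x ≤ p.1
  let E : ℕ × ℕ → Finset (Equiv.Perm (Fin n)) := fun z => Finset.univ.filter fun u =>
    ((A z.1).card : ℝ) * (A z.2).card / n + ε * n ≤ ((A z.1).filter fun p => u p ∈ A z.2).card
  have hsub : (Finset.univ.filter fun u : Equiv.Perm (Fin n) => ¬ IsSpread ε u) ⊆
      (Finset.range (n + 1) ×ˢ Finset.range (n + 1)).biUnion E := by
    intro u hu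
    have hu' := (Finset.mem_filter.mp hu).2
    unfold IsSpread at hu'
    push Not at hu'
    obtain ⟨x, hx, y, hy, hlt⟩ := hu'
    refine Finset.mem_biUnion.mpr ⟨(x, y), ?_, Finset.mem_filter.mpr ⟨Finset.mem_univ _, ?_⟩⟩
    · simp only [Finset.mem_product, Finset.mem_range]
      omega
    · have hx' : ((A x).card : ℝ) = n - x := by
        simp only [A, card_filter_le_val, Nat.cast_sub hx]
      have hy' : ((A y).card : ℝ) = n - y := by
        simp only [A, card_filter_le_val, Nat.cast_sub hy]
      have h1 := congrArg (Nat.cast : ℕ → ℝ) (cornerCount_add_card_le u x y)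
      rw [Nat.cast_add, Nat.cast_sub hx] at h1
      have h2 : (A x).filter (fun p => u p ∈ A y) =
          Finset.univ.filter fun p : Fin n => x ≤ p.1 ∧ y ≤ (u p).1 := by
        simp only [A, Finset.filter_filter, Finset.mem_filter, Finset.mem_univ, true_and]
      dsimp only
      rw [h2, hx', hy']
      have h3 : ((n : ℝ) - x) * (n - y) / n = (n - x) - (n - x) * y / n := by
        field_simp
      rw [h3]
      linarith
  calc _ ≤ (((Finset.range (n + 1) ×ˢ Finset.range (n + 1)).biUnion E).card : ℝ) := by
        exact_mod_cast Finset.card_le_card hsub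
    _ ≤ ∑ z ∈ Finset.range (n + 1) ×ˢ Finset.range (n + 1), ((E z).card : ℝ) := by
        exact_mod_cast Finset.card_biUnion_le
    _ ≤ ∑ _z ∈ Finset.range (n + 1) ×ˢ Finset.range (n + 1),
          (n ! * Real.exp (-(ε ^ 2 / 4) * n)) :=
        Finset.sum_le_sum fun z _ => card_large_intersection_le (A z.1) (A z.2) hε hε2
    _ = _ := by
        rw [Finset.sum_const, Finset.card_product, Finset.card_range, nsmul_eq_mul]
        push_cast
        ring

theorem nonInversions_demazure_le {n : ℕ} {ε : ℝ} (hε : 0 ≤ ε) {u v : Equiv.Perm (Fin n)}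
    (hu : IsSpread ε u) (hv : IsSpread ε v) :
    (nonInversions (demazure u v) : ℝ) ≤ 4 * ε * n ^ 2 := by
  rcases Nat.eq_zero_or_pos n with rfl | hn
  · simp [nonInversions]
  have hn' : (0 : ℝ) < n := by exact_mod_cast hn
  have h := nonInversions_le_of_cornerCount (K := ⌊2 * ε * n⌋₊) (demazure u v) ?_
  · have hK : ((⌊2 * ε * n⌋₊ : ℕ) : ℝ) ≤ 2 * ε * n := Nat.floor_le (by positivity)
    calc (nonInversions (demazure u v) : ℝ) ≤ ((2 * (n * ⌊2 * ε * n⌋₊) : ℕ) : ℝ) := by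
          exact_mod_cast h
      _ = 2 * (n * ((⌊2 * ε * n⌋₊ : ℕ) : ℝ)) := by push_cast; ring
      _ ≤ 2 * (n * (2 * ε * n)) := by gcongr
      _ = _ := by ring
  · intro x hx
    obtain ⟨g, hg, hle⟩ := exists_cornerCount_add_le_demazure u v x (n - x) hx
    have h1 := hu g hg (n - x) (Nat.sub_le _ _)
    have h2 := hv x hx g hg
    rw [Nat.cast_sub hx] at h1
    -- The unknown `g` cancels, which is why the antidiagonal corner `y = n - x` is used.
    have h3 : ((n : ℝ) - g) * (n - x) / n + (n - x) * g / n = n - x := by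
      field_simp
      ring
    have h4 : ((cornerCount u g (n - x) + cornerCount v x g : ℕ) : ℝ) ≤
        cornerCount (demazure u v) x (n - x) := by exact_mod_cast hle
    rw [Nat.cast_add] at h4
    have h5 : n - x - cornerCount (demazure u v) x (n - x) ≤ ⌊2 * ε * n⌋₊ := by
      refine Nat.le_floor ?_
      rcases le_total (cornerCount (demazure u v) x (n - x)) (n - x) with h6 | h6
      · rw [Nat.cast_sub h6, Nat.cast_sub hx]
        linarith
      · rw [Nat.sub_eq_zero_of_le h6]
        simp only [Nat.cast_zero]
        positivity
    omega

/-! ### The Demazure square of the uniform permuton -/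

theorem height_eq (μ : Measure (I × I)) (x y : I) :
    height μ x y = μ.real (Set.Ici x ×ˢ Set.Iic y) := by
  unfold height
  have h1 : Set.Icc x 1 = Set.Ici x := by
    ext t
    simp [unitInterval.le_one']
  have h2 : Set.Icc 0 y = Set.Iic y := by
    ext t
    simp
  rw [h1, h2]

theorem height_uniformPermuton (x y : I) : height uniformPermuton x y = (1 - x) * y := by
  rw [height_eq, uniformPermuton, Measure.volume_eq_prod, measureReal_prod_prod]
  simp [measureReal_def, ENNReal.toReal_ofReal, unitInterval.nonneg y,
    unitInterval.one_minus_nonneg x]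

theorem measurable_graph_symm : Measurable fun t : I => (t, unitInterval.symm t) :=
  measurable_id.prodMk unitInterval.measurable_symm

theorem height_antiDiagonalPermuton (x y : I) :
    height antiDiagonalPermuton x y = min (y : ℝ) (1 - x) := by
  rw [height_eq, antiDiagonalPermuton, measureReal_def, Measure.map_apply measurable_graph_symm
    (measurableSet_Ici.prod measurableSet_Iic)]
  have h : (fun t : I => (t, unitInterval.symm t)) ⁻¹' (Set.Ici x ×ˢ Set.Iic y) =
      Set.Ici (max x (unitInterval.symm y)) := by
    ext t
    simp only [Set.mem_preimage, Set.mem_prod, Set.mem_Ici, Set.mem_Iic, max_le_iff,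
      ← Subtype.coe_le_coe, unitInterval.coe_symm_eq]
    constructor <;> rintro ⟨h1, h2⟩ <;> exact ⟨h1, by linarith⟩
  rw [h, unitInterval.volume_Ici, ENNReal.toReal_ofReal (unitInterval.one_minus_nonneg _)]
  rcases le_total x (unitInterval.symm y) with h | h
  · rw [max_eq_right h]
    rw [← Subtype.coe_le_coe, unitInterval.coe_symm_eq] at h
    rw [unitInterval.coe_symm_eq, min_eq_left (by linarith)]
    ring
  · rw [max_eq_left h]
    rw [← Subtype.coe_le_coe, unitInterval.coe_symm_eq] at h
    rw [min_eq_right (by linarith)]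

theorem isPermuton_antiDiagonalPermuton : IsPermuton antiDiagonalPermuton where
  isProbabilityMeasure := Measure.isProbabilityMeasure_map measurable_graph_symm.aemeasurable
  snd_uniform a b _ := by
    rw [antiDiagonalPermuton, Measure.map_apply measurable_graph_symm
      (MeasurableSet.univ.prod measurableSet_Icc)]
    have : (fun t : I => (t, unitInterval.symm t)) ⁻¹' (Set.univ ×ˢ Set.Icc a b) =
        unitInterval.symm ⁻¹' Set.Icc a b := by
      ext t
      simp
    rw [this, unitInterval.measurePreserving_symm.measure_preimage
      measurableSet_Icc.nullMeasurableSet, unitInterval.volume_Icc]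
  fst_uniform a b _ := by
    rw [antiDiagonalPermuton, Measure.map_apply measurable_graph_symm
      (measurableSet_Icc.prod MeasurableSet.univ)]
    have : (fun t : I => (t, unitInterval.symm t)) ⁻¹' (Set.Icc a b ×ˢ Set.univ) =
        Set.Icc a b := by
      ext t
      simp
    rw [this, unitInterval.volume_Icc]

theorem isLeast_height_add_height_uniformPermuton (x y : I) :
    IsLeast (Set.range fun γ : I => height uniformPermuton γ y + height uniformPermuton x γ)
      (min (y : ℝ) (1 - x)) := by
  simp only [height_uniformPermuton]
  constructor
  -- The function of `γ` interpolates linearly between `y` at `0` and `1 - x` at `1`.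
  · rcases le_total (y : ℝ) (1 - x) with h | h
    · exact ⟨0, by simp [h]⟩
    · exact ⟨1, by simp [h]⟩
  · rintro _ ⟨γ, rfl⟩
    have h0 := unitInterval.nonneg γ
    have h1 := unitInterval.one_minus_nonneg γ
    have h2 : min (y : ℝ) (1 - x) ≤ y := min_le_left _ _
    have h3 : min (y : ℝ) (1 - x) ≤ 1 - x := min_le_right _ _
    have h4 := mul_le_mul_of_nonneg_left h2 h1
    have h5 := mul_le_mul_of_nonneg_right h3 h0
    dsimp only
    linarith

/-- The quadrants `Ici a ×ˢ Iic b` form a π-system generating the σ-algebra. -/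
theorem measure_eq_of_height_eq (μ ν : Measure (I × I)) [IsProbabilityMeasure μ]
    [IsProbabilityMeasure ν] (h : ∀ x y, height μ x y = height ν x y) : μ = ν := by
  have hgen : Prod.instMeasurableSpace = MeasurableSpace.generateFrom
      (Set.image2 (· ×ˢ ·) (Set.range (Set.Ici : I → Set I)) (Set.range (Set.Iic : I → Set I))) := by
    refine (generateFrom_eq_prod ?_ ?_ ?_ ?_).symm
    · rw [← borel_eq_generateFrom_Ici, BorelSpace.measurable_eq (α := I)]
    · rw [← borel_eq_generateFrom_Iic, BorelSpace.measurable_eq (α := I)]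
    · exact ⟨fun _ => Set.Ici 0, fun _ => ⟨0, rfl⟩,
        (Set.iUnion_const _).trans (Set.eq_univ_of_forall fun t => unitInterval.nonneg')⟩
    · exact ⟨fun _ => Set.Iic 1, fun _ => ⟨1, rfl⟩,
        (Set.iUnion_const _).trans (Set.eq_univ_of_forall fun t => unitInterval.le_one')⟩
  refine ext_of_generate_finite _ hgen ?_ ?_ (by simp)
  · rintro _ ⟨_, ⟨a, rfl⟩, _, ⟨b, rfl⟩, rfl⟩ _ ⟨_, ⟨c, rfl⟩, _, ⟨d, rfl⟩, rfl⟩ _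
    refine ⟨_, ⟨a ⊔ c, rfl⟩, _, ⟨b ⊓ d, rfl⟩, ?_⟩
    dsimp only
    rw [Set.prod_inter_prod, Set.Ici_inter_Ici, Set.Iic_inter_Iic]
  · rintro _ ⟨_, ⟨a, rfl⟩, _, ⟨b, rfl⟩, rfl⟩
    have := h a b
    rw [height_eq, height_eq] at this
    exact (measureReal_eq_measureReal_iff).mp this

theorem isDemazureProduct_uniformPermuton_iff (ρ : Measure (I × I)) :
    IsDemazureProduct uniformPermuton uniformPermuton ρ ↔ ρ = antiDiagonalPermuton := by
  constructor
  · rintro ⟨hρ, hleast⟩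
    have := hρ.isProbabilityMeasure
    have := isPermuton_antiDiagonalPermuton.isProbabilityMeasure
    refine measure_eq_of_height_eq _ _ fun x y => ?_
    rw [height_antiDiagonalPermuton]
    exact (hleast x y).unique (isLeast_height_add_height_uniformPermuton x y)
  · rintro rfl
    refine ⟨isPermuton_antiDiagonalPermuton, fun x y => ?_⟩
    rw [height_antiDiagonalPermuton]
    exact isLeast_height_add_height_uniformPermuton x y

/-! ### Pattern densities of permutations with few non-inversions -/

open Classical in
theorem card_strictMono_fin (k n : ℕ) :
    (Finset.univ.filter fun f : Fin k → Fin n => StrictMono f).card = n.choose k := by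
  have e : {f : Fin k → Fin n // StrictMono f} ≃ (Fin k ↪o Fin n) :=
    { toFun := fun f => OrderEmbedding.ofStrictMono f.1 f.2
      invFun := fun f => ⟨f, f.strictMono⟩
      left_inv := fun _ => rfl
      right_inv := fun _ => by ext; rfl }
  rw [← Fintype.card_subtype, ← Nat.card_eq_fintype_card,
    Nat.card_congr (e.trans Set.powersetCard.ofFinEmbEquiv), Set.powersetCard.card,
    Nat.card_eq_fintype_card, Fintype.card_fin]

open Classical in
/-- The number of increasing `k`-tuples of positions at which `u` is not decreasing. -/
noncomputable def nonDecreasingCount {n : ℕ} (k : ℕ) (u : Equiv.Perm (Fin n)) : ℕ :=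
  (Finset.univ.filter fun f : Fin k → Fin n =>
    StrictMono f ∧ ∃ a b : Fin k, a < b ∧ u (f a) < u (f b)).card

/-- A bad tuple has a non-inversion at some pair of indices (at most `k²` choices) and `k - 2`
further entries. The factor `n ^ 2` on the left avoids the exponent `k - 2`. -/
theorem nonDecreasingCount_mul_sq_le {n : ℕ} (k : ℕ) (u : Equiv.Perm (Fin n)) :
    nonDecreasingCount k u * n ^ 2 ≤ k ^ 2 * (nonInversions u * n ^ k) := by
  classical
  let E : Fin k × Fin k → Finset (Fin k → Fin n) := fun z => Finset.univ.filter fun f =>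
    StrictMono f ∧ z.1 < z.2 ∧ u (f z.1) < u (f z.2)
  have hE : ∀ z, (E z).card * n ^ 2 ≤ nonInversions u * n ^ k := by
    rintro ⟨a, b⟩
    by_cases hab : a < b
    · let C : Finset (Fin k) := Finset.univ \ {a, b}
      have hC : Fintype.card C + 2 = k := by
        have h1 : ({a, b} : Finset (Fin k)).card = 2 := Finset.card_pair hab.ne
        have h2 := Finset.card_sdiff_add_card_eq_card (Finset.subset_univ ({a, b} : Finset (Fin k)))
        rw [h1, Finset.card_univ, Fintype.card_fin] at h2
        rwa [Fintype.card_coe]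
      have hcard : (E (a, b)).card ≤ ((Finset.univ.filter fun p : Fin n × Fin n =>
          p.1 < p.2 ∧ u p.1 < u p.2) ×ˢ (Finset.univ : Finset (C → Fin n))).card := by
        refine Finset.card_le_card_of_injOn (fun f => ((f a, f b), fun c => f c.1)) ?_ ?_
        · intro f hf
          have h := (Finset.mem_filter.mp (Finset.mem_coe.mp hf)).2
          exact Finset.mem_coe.mpr (Finset.mem_product.mpr
            ⟨Finset.mem_filter.mpr ⟨Finset.mem_univ _, h.1 h.2.1, h.2.2⟩, Finset.mem_univ _⟩)
        · intro f _ g _ hfg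
          simp only [Prod.mk.injEq] at hfg
          funext c
          by_cases hc : c ∈ C
          · exact congrFun hfg.2 ⟨c, hc⟩
          · simp only [C, Finset.mem_sdiff, Finset.mem_univ, true_and, not_not,
              Finset.mem_insert, Finset.mem_singleton] at hc
            rcases hc with rfl | rfl
            · exact hfg.1.1
            · exact hfg.1.2
      rw [Finset.card_product, Finset.card_univ, Fintype.card_fun, Fintype.card_fin] at hcard
      calc (E (a, b)).card * n ^ 2 ≤ nonInversions u * n ^ Fintype.card C * n ^ 2 :=
            Nat.mul_le_mul_right _ hcard
        _ = nonInversions u * n ^ k := by rw [mul_assoc, ← pow_add, hC]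
    · have : E (a, b) = ∅ := Finset.filter_eq_empty_iff.mpr fun f _ h => hab h.2.1
      simp [this]
  have hsub : (Finset.univ.filter fun f : Fin k → Fin n =>
      StrictMono f ∧ ∃ a b : Fin k, a < b ∧ u (f a) < u (f b)) ⊆ Finset.univ.biUnion E := by
    intro f hf
    obtain ⟨hm, a, b, hab, h⟩ := (Finset.mem_filter.mp hf).2
    exact Finset.mem_biUnion.mpr ⟨(a, b), Finset.mem_univ _,
      Finset.mem_filter.mpr ⟨Finset.mem_univ _, hm, hab, h⟩⟩
  calc nonDecreasingCount k u * n ^ 2 ≤ (∑ z, (E z).card) * n ^ 2 :=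
        Nat.mul_le_mul_right _ ((Finset.card_le_card hsub).trans Finset.card_biUnion_le)
    _ = ∑ z, (E z).card * n ^ 2 := Finset.sum_mul _ _ _
    _ ≤ ∑ _z : Fin k × Fin k, nonInversions u * n ^ k := Finset.sum_le_sum fun z _ => hE z
    _ = k ^ 2 * (nonInversions u * n ^ k) := by
      simp [sq]

theorem patternCount_revPerm_add {n k : ℕ} (u : Equiv.Perm (Fin n)) :
    patternCount (Fin.revPerm : Equiv.Perm (Fin k)) u + nonDecreasingCount k u = n.choose k := by
  classical
  rw [← card_strictMono_fin k n, ← Finset.card_filter_add_card_filter_not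
    (s := Finset.univ.filter fun f : Fin k → Fin n => StrictMono f)
    (fun f => ∀ a b : Fin k, u (f a) < u (f b) ↔ (Fin.revPerm a : Fin k) < Fin.revPerm b)]
  simp only [Finset.filter_filter]
  unfold patternCount nonDecreasingCount
  congr 1
  · refine congrArg Finset.card (Finset.filter_congr fun f _ => and_congr_right fun hf => ?_)
    simp only [Fin.revPerm_apply, Fin.rev_lt_rev]
    constructor
    · rintro ⟨a, b, hab, h⟩ h'
      exact absurd ((h' a b).mp h) (not_lt.mpr hab.le)
    · intro h
      by_contra hne
      push Not at hne
      refine h fun a b => ⟨fun hlt => ?_, fun hlt => ?_⟩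
      · by_contra hba
        rcases (not_lt.mp hba).lt_or_eq with h1 | h1
        · exact absurd hlt (not_lt.mpr (hne a b h1))
        · exact absurd hlt (by rw [h1]; exact lt_irrefl _)
      · exact lt_of_le_of_ne (hne b a hlt) fun e => hlt.ne' (hf.injective (u.injective e))

/-- A `w` without ascending pairs, followed by reversal, is an order automorphism of `Fin k`, hence
the identity. So any other `w` forces an ascending pair in each occurrence. -/
theorem patternCount_le_of_ne_revPerm {n k : ℕ} (w : Equiv.Perm (Fin k)) (hw : w ≠ Fin.revPerm)
    (u : Equiv.Perm (Fin n)) : patternCount w u ≤ nonDecreasingCount k u := by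
  classical
  refine Finset.card_le_card fun f hf => ?_
  obtain ⟨hm, h⟩ := (Finset.mem_filter.mp hf).2
  refine Finset.mem_filter.mpr ⟨Finset.mem_univ _, hm, ?_⟩
  by_contra hne
  push Not at hne
  apply hw
  have hanti : StrictMono fun a => (Fin.revPerm (w a) : Fin k) := by
    intro a b hab
    simp only [Fin.revPerm_apply, Fin.rev_lt_rev]
    refine lt_of_le_of_ne (not_lt.mp fun hlt => ?_) fun e => hab.ne' (w.injective e)
    exact absurd ((h a b).mpr hlt) (not_lt.mpr (hne a b hab))
  have hid : (fun a => (Fin.revPerm (w a) : Fin k)) = id := by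
    have h1 := Subsingleton.elim
      (hanti.orderIsoOfSurjective _ (w.trans Fin.revPerm).surjective) (OrderIso.refl _)
    exact congrArg (fun e : Fin k ≃o Fin k => (e : Fin k → Fin k)) h1
  refine Equiv.ext fun a => ?_
  have h2 := congrArg Fin.rev (congrFun hid a)
  rwa [Fin.revPerm_apply, Fin.rev_rev] at h2

theorem nonDecreasingCount_div_choose_le {n k : ℕ} (hn : 0 < n) (hk : 2 * k ≤ n)
    (u : Equiv.Perm (Fin n)) :
    (nonDecreasingCount k u : ℝ) / n.choose k ≤
      (k ^ 2 * k ! * 2 ^ k : ℝ) * (nonInversions u / n ^ 2) := by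
  have hn' : (0 : ℝ) < n := by exact_mod_cast hn
  have hc : (0 : ℝ) < n.choose k := by exact_mod_cast Nat.choose_pos (by omega)
  have h1 : (nonDecreasingCount k u : ℝ) * n ^ 2 ≤ k ^ 2 * (nonInversions u * n ^ k) := by
    exact_mod_cast nonDecreasingCount_mul_sq_le k u
  -- From `(n + 1 - k) ^ k ≤ k ! * n.choose k` and `n ≤ 2 (n + 1 - k)`.
  have h2 : (n : ℝ) ^ k ≤ k ! * 2 ^ k * n.choose k := by
    have h3 := Nat.pow_le_choose (α := ℝ) k n
    rw [div_le_iff₀ (by exact_mod_cast k.factorial_pos)] at h3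
    have h4 : (n : ℝ) ≤ 2 * ((n + 1 - k : ℕ) : ℝ) := by
      exact_mod_cast (show n ≤ 2 * (n + 1 - k) by omega)
    calc (n : ℝ) ^ k ≤ (2 * ((n + 1 - k : ℕ) : ℝ)) ^ k := pow_le_pow_left₀ hn'.le h4 k
      _ = 2 ^ k * ((n + 1 - k : ℕ) : ℝ) ^ k := mul_pow _ _ _
      _ ≤ 2 ^ k * (n.choose k * k !) := by
          refine mul_le_mul_of_nonneg_left ?_ (by positivity)
          exact_mod_cast h3
      _ = _ := by ring
  rw [div_le_iff₀ hc]
  have h5 : (nonDecreasingCount k u : ℝ) ≤ k ^ 2 * (nonInversions u * n ^ k) / n ^ 2 := by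
    rwa [le_div_iff₀ (by positivity)]
  refine h5.trans ?_
  calc (k : ℝ) ^ 2 * (nonInversions u * n ^ k) / n ^ 2
      = (k : ℝ) ^ 2 * (nonInversions u / n ^ 2) * n ^ k := by ring
    _ ≤ (k : ℝ) ^ 2 * (nonInversions u / n ^ 2) * (k ! * 2 ^ k * n.choose k) :=
        mul_le_mul_of_nonneg_left h2 (by positivity)
    _ = _ := by ring

theorem tendsto_patternDensity {x : (n : ℕ) → Equiv.Perm (Fin n)}
    (hx : Tendsto (fun n => (nonInversions (x n) : ℝ) / n ^ 2) atTop (𝓝 0)) {k : ℕ}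
    (w : Equiv.Perm (Fin k)) :
    Tendsto (fun n => patternDensity w (x n)) atTop (𝓝 (if w = Fin.revPerm then 1 else 0)) := by
  have hbad : Tendsto (fun n => (nonDecreasingCount k (x n) : ℝ) / n.choose k) atTop (𝓝 0) := by
    have h1 := hx.const_mul (k ^ 2 * k ! * 2 ^ k : ℝ)
    rw [mul_zero] at h1
    refine tendsto_of_tendsto_of_tendsto_of_le_of_le' tendsto_const_nhds h1
      (Eventually.of_forall fun n => by positivity) ?_
    filter_upwards [eventually_ge_atTop (2 * k), eventually_gt_atTop 0] with n hn hn0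
    exact nonDecreasingCount_div_choose_le hn0 hn (x n)
  split_ifs with hw
  · subst hw
    have h1 := hbad.const_sub 1
    rw [sub_zero] at h1
    refine h1.congr' ?_
    filter_upwards [eventually_ge_atTop k] with n hn
    have hc : (n.choose k : ℝ) ≠ 0 := by exact_mod_cast (Nat.choose_pos hn).ne'
    have h2 : (patternCount (Fin.revPerm : Equiv.Perm (Fin k)) (x n) : ℝ) +
        nonDecreasingCount k (x n) = n.choose k := by
      exact_mod_cast patternCount_revPerm_add (k := k) (x n)
    rw [patternDensity, eq_div_iff hc, sub_mul, div_mul_cancel₀ _ hc]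
    linarith
  · refine tendsto_of_tendsto_of_tendsto_of_le_of_le tendsto_const_nhds hbad
      (fun n => ?_) (fun n => ?_)
    · unfold patternDensity
      positivity
    · unfold patternDensity
      gcongr
      exact patternCount_le_of_ne_revPerm w hw (x n)

/-! ### Almost sure convergence -/

theorem measure_not_isSpread_le {Ω : Type*} [MeasurableSpace Ω] (P : Measure Ω) {n : ℕ}
    (u : Ω → Equiv.Perm (Fin n)) (hu : ∀ p, P {ω | u ω = p} = ((n ! : ℕ) : ℝ≥0∞)⁻¹) {ε : ℝ}
    (hε : 0 ≤ ε) (hε2 : ε ≤ 2) :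
    P {ω | ¬ IsSpread ε (u ω)} ≤
      ENNReal.ofReal (((n : ℝ) + 1) ^ 2 * Real.exp (-(ε ^ 2 / 4) * n)) := by
  classical
  set F := Finset.univ.filter fun p : Equiv.Perm (Fin n) => ¬ IsSpread ε p
  have hset : {ω | ¬ IsSpread ε (u ω)} ⊆ ⋃ p ∈ F, {ω | u ω = p} := by
    intro ω hω
    exact Set.mem_biUnion (show u ω ∈ (F : Set _) from
      Finset.mem_coe.mpr (Finset.mem_filter.mpr ⟨Finset.mem_univ _, hω⟩)) rfl
  have hf : (0 : ℝ) < n ! := by exact_mod_cast n.factorial_pos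
  calc P {ω | ¬ IsSpread ε (u ω)} ≤ ∑ p ∈ F, P {ω | u ω = p} :=
        (measure_mono hset).trans (measure_biUnion_finset_le _ _)
    _ = ENNReal.ofReal ((F.card : ℝ) * ((n ! : ℕ) : ℝ)⁻¹) := by
        rw [Finset.sum_congr rfl fun p _ => hu p, Finset.sum_const, nsmul_eq_mul,
          ENNReal.ofReal_mul (Nat.cast_nonneg _), ENNReal.ofReal_inv_of_pos hf,
          ENNReal.ofReal_natCast, ENNReal.ofReal_natCast]
    _ ≤ _ := by
        refine ENNReal.ofReal_le_ofReal ?_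
        rw [← div_eq_mul_inv, div_le_iff₀ hf]
        refine (card_not_isSpread_le hε hε2).trans_eq ?_
        ring

theorem summable_succ_sq_mul_exp {r : ℝ} (hr : 0 < r) :
    Summable fun n : ℕ => ((n : ℝ) + 1) ^ 2 * Real.exp (-r * n) := by
  have h2 := Real.summable_pow_mul_exp_neg_nat_mul 2 hr
  have h1 := (Real.summable_pow_mul_exp_neg_nat_mul 1 hr).mul_left 2
  have h0 := Real.summable_pow_mul_exp_neg_nat_mul 0 hr
  refine ((h2.add h1).add h0).congr fun n => ?_
  ring

theorem ae_eventually_isSpread {Ω : Type*} [MeasurableSpace Ω] (P : Measure Ω)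
    (u : (n : ℕ) → Ω → Equiv.Perm (Fin n))
    (hu : ∀ n p, P {ω | u n ω = p} = ((n ! : ℕ) : ℝ≥0∞)⁻¹) {ε : ℝ}
    (hε : 0 < ε) (hε2 : ε ≤ 2) :
    ∀ᵐ ω ∂P, ∀ᶠ n in atTop, IsSpread ε (u n ω) := by
  have h := ae_eventually_notMem (μ := P) (s := fun n => {ω | ¬ IsSpread ε (u n ω)})
    (ne_top_of_le_ne_top
      (summable_succ_sq_mul_exp (r := ε ^ 2 / 4) (by positivity)).tsum_ofReal_ne_top
      (ENNReal.tsum_le_tsum fun n => measure_not_isSpread_le P (u n) (hu n) hε.le hε2))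
  filter_upwards [h] with ω hω
  filter_upwards [hω] with n hn
  exact not_not.mp hn

theorem ae_tendsto_nonInversions {Ω : Type*} [MeasurableSpace Ω] (P : Measure Ω)
    (u v : (n : ℕ) → Ω → Equiv.Perm (Fin n))
    (hu : ∀ n p, P {ω | u n ω = p} = ((n ! : ℕ) : ℝ≥0∞)⁻¹)
    (hv : ∀ n p, P {ω | v n ω = p} = ((n ! : ℕ) : ℝ≥0∞)⁻¹) :
    ∀ᵐ ω ∂P, Tendsto (fun n => (nonInversions (demazure (u n ω) (v n ω)) : ℝ) / n ^ 2) atTop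
      (𝓝 0) := by
  have hpos : ∀ m : ℕ, (0 : ℝ) < 1 / ((m : ℝ) + 1) := fun m => Nat.one_div_pos_of_nat
  have hle : ∀ m : ℕ, 1 / ((m : ℝ) + 1) ≤ 2 := fun m => by
    rw [div_le_iff₀ (by positivity)]
    linarith [Nat.cast_nonneg (α := ℝ) m]
  -- The countable sequence `ε = 1 / (m + 1)` yields a single null set.
  have hu' := ae_all_iff.mpr fun m : ℕ => ae_eventually_isSpread P u hu (hpos m) (hle m)
  have hv' := ae_all_iff.mpr fun m : ℕ => ae_eventually_isSpread P v hv (hpos m) (hle m)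
  filter_upwards [hu', hv'] with ω h1 h2
  refine tendsto_order.mpr ⟨fun a ha => Eventually.of_forall fun n =>
    lt_of_lt_of_le ha (by positivity), fun a ha => ?_⟩
  obtain ⟨m, hm⟩ := exists_nat_one_div_lt (show 0 < a / 4 by positivity)
  filter_upwards [h1 m, h2 m, eventually_gt_atTop 0] with n hn1 hn2 hn0
  have hn : (0 : ℝ) < n := by exact_mod_cast hn0
  rw [div_lt_iff₀ (by positivity)]
  have h3 := nonInversions_demazure_le (hpos m).le hn1 hn2
  have h4 : 4 * (1 / ((m : ℝ) + 1)) * n ^ 2 < a * n ^ 2 :=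
    mul_lt_mul_of_pos_right (by linarith) (by positivity)
  linarith

/-! ### Expected number of inversions -/

theorem tendsto_integral_nonInversions {Ω : Type*} [MeasurableSpace Ω] (P : Measure Ω)
    [IsProbabilityMeasure P] (x : (n : ℕ) → Ω → Equiv.Perm (Fin n)) (hx : ∀ n, Measurable (x n))
    (h : ∀ᵐ ω ∂P, Tendsto (fun n => (nonInversions (x n ω) : ℝ) / n ^ 2) atTop (𝓝 0)) :
    Tendsto (fun n => ∫ ω, (nonInversions (x n ω) : ℝ) / n.choose 2 ∂P) atTop (𝓝 0) := by
  have h0 := tendsto_integral_of_dominated_convergence (μ := P)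
    (F := fun n ω => (nonInversions (x n ω) : ℝ) / n.choose 2) (f := fun _ => 0)
    (fun _ => (1 : ℝ)) (fun n => ?_) (integrable_const _) (fun n => ?_) ?_
  · simpa using h0
  · exact ((measurable_from_top (f := fun p : Equiv.Perm (Fin n) =>
      (nonInversions p : ℝ) / n.choose 2)).comp (hx n)).aestronglyMeasurable
  · refine Eventually.of_forall fun ω => ?_
    rw [Real.norm_of_nonneg (by positivity)]
    refine div_le_one_of_le₀ ?_ (Nat.cast_nonneg _)
    exact_mod_cast (inversions_add_nonInversions (x n ω)).le.trans' (Nat.le_add_left _ _)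
  · filter_upwards [h] with ω hω
    have h1 := hω.const_mul 4
    rw [mul_zero] at h1
    refine tendsto_of_tendsto_of_tendsto_of_le_of_le' tendsto_const_nhds h1
      (Eventually.of_forall fun n => by positivity) ?_
    filter_upwards [eventually_ge_atTop 2] with n hn
    have hn' : (2 : ℝ) ≤ n := by exact_mod_cast hn
    rw [Nat.cast_choose_two, ← mul_div_assoc, div_le_div_iff₀ (by nlinarith) (by positivity)]
    have h2 : (n : ℝ) ^ 2 ≤ 4 * (n * (n - 1) / 2) := by nlinarith
    calc (nonInversions (x n ω) : ℝ) * n ^ 2 ≤ nonInversions (x n ω) * (4 * (n * (n - 1) / 2)) :=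
          mul_le_mul_of_nonneg_left h2 (Nat.cast_nonneg _)
      _ = _ := by ring

theorem integral_inversions {Ω : Type*} [MeasurableSpace Ω] (P : Measure Ω)
    [IsProbabilityMeasure P] {n : ℕ} (x : Ω → Equiv.Perm (Fin n)) (hx : Measurable x) :
    ∫ ω, (inversions (x ω) : ℝ) ∂P =
      n.choose 2 * (1 - ∫ ω, (nonInversions (x ω) : ℝ) / n.choose 2 ∂P) := by
  have hint : Integrable (fun ω => (nonInversions (x ω) : ℝ)) P := by
    refine Integrable.of_bound (C := n.choose 2) ((measurable_from_top
      (f := fun p : Equiv.Perm (Fin n) => (nonInversions p : ℝ))).comp hx).aestronglyMeasurable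
      (Eventually.of_forall fun ω => ?_)
    rw [Real.norm_of_nonneg (by positivity)]
    exact_mod_cast (inversions_add_nonInversions (x ω)).le.trans' (Nat.le_add_left _ _)
  have h : ∀ ω, (inversions (x ω) : ℝ) = n.choose 2 - nonInversions (x ω) := by
    intro ω
    rw [eq_sub_iff_add_eq]
    exact_mod_cast inversions_add_nonInversions (x ω)
  simp only [h]
  rw [integral_sub (integrable_const _) hint, integral_const, probReal_univ, one_smul,
    integral_div]
  -- For `n < 2` the quotient by `n.choose 2 = 0` is zero by convention, and both sides vanish.
  rcases Nat.eq_zero_or_pos (n.choose 2) with h0 | h0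
  · have h1 : ∀ ω, nonInversions (x ω) = 0 := fun ω => by
      have := inversions_add_nonInversions (x ω)
      omega
    simp [h0, h1]
  · have : (n.choose 2 : ℝ) ≠ 0 := by exact_mod_cast h0.ne'
    field_simp

end DemazurePermuton

open DemazurePermuton in
theorem theorem3p3 {Ω : Type*} [MeasurableSpace Ω] (P : Measure Ω) [IsProbabilityMeasure P]
    -- for each `n`, independent uniformly random permutations `u n`, `v n` of size `n`
    (u v : (n : ℕ) → Ω → Equiv.Perm (Fin n))
    (hu_meas : ∀ n, Measurable (u n)) (hv_meas : ∀ n, Measurable (v n))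
    (hu_unif : ∀ n (p : Equiv.Perm (Fin n)), P {ω | u n ω = p} = ((n ! : ℕ) : ℝ≥0∞)⁻¹)
    (hv_unif : ∀ n (p : Equiv.Perm (Fin n)), P {ω | v n ω = p} = ((n ! : ℕ) : ℝ≥0∞)⁻¹)
    (h_indep : ∀ n, IndepFun (u n) (v n) P) :
    -- pattern densities of the Demazure products (`Fin.revPerm` is the decreasing permutation)
    (∀ (k : ℕ) (w : Equiv.Perm (Fin k)), ∀ᵐ ω ∂P,
      Tendsto (fun n => patternDensity w (demazure (u n ω) (v n ω))) atTop
        (𝓝 (if w = Fin.revPerm then 1 else 0))) ∧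
    -- expected number of inversions
    (∃ ε : ℕ → ℝ, Tendsto ε atTop (𝓝 0) ∧
      ∀ n, ∫ ω, (inversions (demazure (u n ω) (v n ω)) : ℝ) ∂P
        = (n.choose 2 : ℝ) * (1 - ε n)) ∧
    -- the Demazure square of the uniform permuton is the anti-diagonal permuton
    (∀ ρ : Measure (I × I),
      IsDemazureProduct uniformPermuton uniformPermuton ρ ↔ ρ = antiDiagonalPermuton) := by
  have hae := ae_tendsto_nonInversions P u v hu_unif hv_unif
  have hmeas : ∀ n, Measurable fun ω => demazure (u n ω) (v n ω) := fun n => by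
    have : DiscreteMeasurableSpace (Equiv.Perm (Fin n)) := ⟨fun _ => trivial⟩
    exact (Measurable.of_discrete (f := fun p : Equiv.Perm (Fin n) × Equiv.Perm (Fin n) =>
      demazure p.1 p.2)).comp ((hu_meas n).prodMk (hv_meas n))
  -- The error `ε n` is the expected proportion of non-inversions among all pairs.
  refine ⟨fun k w => ?_, ⟨_, tendsto_integral_nonInversions P _ hmeas hae,
    fun n => integral_inversions P _ (hmeas n)⟩, isDemazureProduct_uniformPermuton_iff⟩
  filter_upwards [hae] with ω hω
  exact tendsto_patternDensity hω w
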